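/- Let $\Sigma\subset\mathbb R^3$ be a cyclic surface, that is, an immersed surface swept out by a smooth one-parameter family of circles: $\Sigma$ is parametrized by an immersion $$X(s,\theta)=c(s)+r(s)\,(\cos\theta\,u(s)+\sin\theta\,v(s)),\qquad s\in I,\ \theta\in\mathbb R,$$ where $I\subset\mathbb R$ is a non-empty open interval, $c,u,v\colon I\to\mathbb R^3$ and $r\colon I\to(0,\infty)$ are smooth, and $u(s),v(s)$ are orthonormal for each $s$. The planes $c(s)+\operatorname{span}\{u(s),v(s)\}$ are called the planes of the foliation. Let $\nu=(\nu_1,\nu_2,\nu_3)=X_s\times X_\theta/|X_s\times X_\theta|$ be the unit normal of $\Sigma$ and let $H$ be its mean curvature (half the trace of the second fundamental form $\langle\nu,d^2X\rangle$). The Dirichlet energy is $\int_\Sigma F(\nu)\,d\Sigma$ with $F(\nu)=\frac1{\nu_3}-\nu_3$, and its anisotropic mean curvature is $2HF(\nu)-\operatorname{div}_\Sigma\big(DF(\nu)\big)$, where $DF$ is the gradient of $F$ on the unit sphere $\mathbb S^2$. Assume that $\Sigma$ is a CAMC surface of the Dirichlet energy, that is, $\nu_3\neq0$ everywhere on $\Sigma$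 and the anisotropic mean curvature is equal to a constant $\Lambda$. If $\Lambda\neq0$, then all planes of the foliation are parallel to each other. If, in addition, these planes are parallel to the $xy$-plane, then $\Sigma$ is a surface of revolution about an axis parallel to the $z$-axis: there is a vertical line that contains the centres of all the circles, is orthogonal to all planes of the foliation, and is such that $\Sigma$ is invariant under every rotation about it. -/

import Mathlib

open scoped ContDiff

noncomputable section

/-- Euclidean space `ℝ³`. -/
abbrev E3 : Type := EuclideanSpace ℝ (Fin 3)

/-- The vertical unit vector `e₃ = (0, 0, 1)`. -/
def e3 : E3 := EuclideanSpace.single 2 1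

/-! ### Parametrized surfaces in `ℝ³`

A parametrization is a map `X : ℝ → ℝ → E3`, `(s, θ) ↦ X s θ`, which is only looked at on an open
set of parameters where it is smooth. -/

namespace ParamSurface

/-- Partial derivative in the first parameter of a map with values in `ℝ³`. -/
def d1 (V : ℝ → ℝ → E3) (s θ : ℝ) : E3 := deriv (fun σ => V σ θ) s

/-- Partial derivative in the second parameter of a map with values in `ℝ³`. -/
def d2 (V : ℝ → ℝ → E3) (s θ : ℝ) : E3 := deriv (fun τ => V s τ) θ

/-- The vector product of `ℝ³`. -/
def cross (v w : E3) : E3 := WithLp.toLp 2 (crossProduct (WithLp.ofLp v) (WithLp.ofLp w))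

/-- The immersion condition at a point. -/
def IsImmersedAt (X : ℝ → ℝ → E3) (s θ : ℝ) : Prop :=
  LinearIndependent ℝ ![d1 X s θ, d2 X s θ]

/-- The unit normal (Gauss map) `ν = X_s × X_θ / |X_s × X_θ|`. -/
def unitNormal (X : ℝ → ℝ → E3) (s θ : ℝ) : E3 :=
  ‖cross (d1 X s θ) (d2 X s θ)‖⁻¹ • cross (d1 X s θ) (d2 X s θ)

/-- Coefficients of the first fundamental form. -/
def g11 (X : ℝ → ℝ → E3) (s θ : ℝ) : ℝ := inner ℝ (d1 X s θ) (d1 X s θ)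
def g12 (X : ℝ → ℝ → E3) (s θ : ℝ) : ℝ := inner ℝ (d1 X s θ) (d2 X s θ)
def g22 (X : ℝ → ℝ → E3) (s θ : ℝ) : ℝ := inner ℝ (d2 X s θ) (d2 X s θ)

/-- Determinant of the first fundamental form. -/
def detG (X : ℝ → ℝ → E3) (s θ : ℝ) : ℝ := g11 X s θ * g22 X s θ - g12 X s θ ^ 2

/-- Coefficients of the second fundamental form with respect to `ν`. -/
def h11 (X : ℝ → ℝ → E3) (s θ : ℝ) : ℝ := inner ℝ (unitNormal X s θ) (d1 (d1 X) s θ)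
def h12 (X : ℝ → ℝ → E3) (s θ : ℝ) : ℝ := inner ℝ (unitNormal X s θ) (d2 (d1 X) s θ)
def h22 (X : ℝ → ℝ → E3) (s θ : ℝ) : ℝ := inner ℝ (unitNormal X s θ) (d2 (d2 X) s θ)

/-- The mean curvature `H`: half of the trace of the second fundamental form. -/
def meanCurvature (X : ℝ → ℝ → E3) (s θ : ℝ) : ℝ :=
  (g22 X s θ * h11 X s θ - 2 * g12 X s θ * h12 X s θ + g11 X s θ * h22 X s θ) / (2 * detG X s θ)

/-- The divergence `div_Σ V = ∑ gⁱʲ ⟨∂ᵢ V, ∂ⱼ X⟩` along the surface `X` of a field `V`. -/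
def surfaceDiv (X V : ℝ → ℝ → E3) (s θ : ℝ) : ℝ :=
  (g22 X s θ * inner ℝ (d1 V s θ) (d1 X s θ)
    - g12 X s θ * (inner ℝ (d1 V s θ) (d2 X s θ) + inner ℝ (d2 V s θ) (d1 X s θ))
    + g11 X s θ * inner ℝ (d2 V s θ) (d2 X s θ)) / detG X s θ

/-- The gradient on the unit sphere at `ν` of (the restriction of) a function `F` that is
differentiable near `ν` in `ℝ³`: the part of the gradient in `ℝ³` tangent to the sphere. -/
def sphereGrad (F : E3 → ℝ) (ν : E3) : E3 :=
  gradient F ν - (inner ℝ (gradient F ν) ν : ℝ) • ν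

/-- The anisotropic mean curvature `2 H F(ν) - div_Σ (DF(ν))` of the energy `∫_Σ F(ν) dΣ`. -/
def anisotropicMeanCurvature (F : E3 → ℝ) (X : ℝ → ℝ → E3) (s θ : ℝ) : ℝ :=
  2 * meanCurvature X s θ * F (unitNormal X s θ)
    - surfaceDiv X (fun σ τ => sphereGrad F (unitNormal X σ τ)) s θ

end ParamSurface

/-- The integrand `F(ν) = 1/ν₃ - ν₃` of the Dirichlet energy, used only where `ν₃ ≠ 0`. -/
def dirichletIntegrand (ν : E3) : ℝ := 1 / ν 2 - ν 2

/-- A cyclic surface: an immersed surface swept out by a smooth one-parameter family of circles.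
The circle with parameter `s` has centre `c s` and radius `r s`, and lies in the plane through
`c s` spanned by the orthonormal vectors `u s`, `v s`. The parameter runs over an open interval
`I`, bounded or not. -/
structure CyclicSurface where
  I : Set ℝ
  c : ℝ → E3
  r : ℝ → ℝ
  u : ℝ → E3
  v : ℝ → E3
  isOpen_I : IsOpen I
  ordConnected_I : I.OrdConnected
  nonempty_I : I.Nonempty
  smooth_c : ContDiffOn ℝ ∞ c I
  smooth_r : ContDiffOn ℝ ∞ r I
  smooth_u : ContDiffOn ℝ ∞ u I
  smooth_v : ContDiffOn ℝ ∞ v I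
  r_pos : ∀ s ∈ I, 0 < r s
  orthonormal : ∀ s ∈ I, Orthonormal ℝ ![u s, v s]
  immersed : ∀ s ∈ I, ∀ θ : ℝ, ParamSurface.IsImmersedAt
    (fun σ τ => c σ + r σ • (Real.cos τ • u σ + Real.sin τ • v σ)) s θ

namespace CyclicSurface

/-- The parametrization `X(s, θ) = c(s) + r(s) (cos θ u(s) + sin θ v(s))`. -/
def X (S : CyclicSurface) (s θ : ℝ) : E3 :=
  S.c s + S.r s • (Real.cos θ • S.u s + Real.sin θ • S.v s)

/-- The points of the surface. -/
def carrier (S : CyclicSurface) : Set E3 := {x | ∃ s ∈ S.I, ∃ θ : ℝ, x = S.X s θ}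

/-- The plane of the foliation that contains the circle with parameter `s`. -/
def plane (S : CyclicSurface) (s : ℝ) : AffineSubspace ℝ E3 :=
  AffineSubspace.mk' (S.c s) (Submodule.span ℝ {S.u s, S.v s})

/-- `S` has constant anisotropic mean curvature `Λ` for the Dirichlet energy. The integrand is
defined for `ν₃ ≠ 0` only, which is part of the condition. -/
def IsDirichletCAMC (S : CyclicSurface) (Λ : ℝ) : Prop :=
  ∀ s ∈ S.I, ∀ θ : ℝ, ParamSurface.unitNormal S.X s θ 2 ≠ 0 ∧
    ParamSurface.anisotropicMeanCurvature dirichletIntegrand S.X s θ = Λ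

/-- `S` is a surface of revolution about the line through `p` with direction `d`: it is invariant
under every rotation about that line, and its circles are coaxial, that is, their centres lie on
the line and their planes are orthogonal to it. -/
def IsSurfaceOfRevolutionAbout (S : CyclicSurface) (p d : E3) : Prop :=
  d ≠ 0 ∧
  (∀ ρ : E3 ≃ₗᵢ[ℝ] E3, LinearMap.det (ρ.toLinearEquiv : E3 →ₗ[ℝ] E3) = 1 → ρ d = d →
    (fun x => p + ρ (x - p)) '' S.carrier = S.carrier) ∧
  (∀ s ∈ S.I, S.c s ∈ AffineSubspace.mk' p (Submodule.span ℝ {d}) ∧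
    (S.plane s).direction = (Submodule.span ℝ {d})ᗮ)

end CyclicSurface

/-- The `xy`-plane. -/
def xyPlane : AffineSubspace ℝ E3 := AffineSubspace.mk' 0 (Submodule.span ℝ {e3})ᗮ

end

/-! ### Vector algebra in ℝ³, the derivative of the unit normal, and the spherical gradient of F. -/

namespace ParamSurface

/-! Where ν₃ ≠ 0 the surface is locally a graph z = f(x, y), its Dirichlet energy is ∫ |∇f|² up to
sign, and the anisotropic mean curvature is 2Δf. In an arbitrary parametrization, with N = X_s ×
X_θ, this becomes an equation with Λ N₃³ on one side and a polynomial in the first and second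
derivatives of X on the other (`anisotropicMeanCurvature_dirichlet`).

Along a circle both sides are trigonometric polynomials in θ. N₃ has degree at most 2, so its cube
could reach degree 6, but the other side has degree at most 5. As Λ ≠ 0, the second Fourier
coefficient of N₃ vanishes (`cross_fourier_eq_zero`). For the unit normal n of the planes this means
that n' = 0 wherever the plane is not horizontal; on a horizontal plane n' is horizontal anyway.
Hence n₃ is constant, so either all planes are horizontal or none is, and n is constant in both
cases (`IsDirichletCAMC.n_eq`).

If all planes are horizontal, N₃ has degree at most 1 and the other side drops to degree 2. The same
comparison, now of degree 3 with degree 2, removes the first Fourier coefficient of N₃, which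
measures the horizontal velocity of the centre (`horizontal_velocity_eq_zero`). The centres then lie
on a vertical line. -/

theorem inner_eq (x y : E3) : inner ℝ x y = x 0 * y 0 + x 1 * y 1 + x 2 * y 2 := by
  simp [PiLp.inner_apply, Fin.sum_univ_three]; ring

theorem cross_apply_zero (x y : E3) : cross x y 0 = x 1 * y 2 - x 2 * y 1 := by
  simp [cross, crossProduct]

theorem cross_apply_one (x y : E3) : cross x y 1 = x 2 * y 0 - x 0 * y 2 := by
  simp [cross, crossProduct]

theorem cross_apply_two (x y : E3) : cross x y 2 = x 0 * y 1 - x 1 * y 0 := by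
  simp [cross, crossProduct]

theorem _root_.HasDerivAt.coord {f : ℝ → E3} {f' : E3} {t : ℝ} (h : HasDerivAt f f' t)
    (i : Fin 3) : HasDerivAt (fun x => f x i) (f' i) t :=
  (EuclideanSpace.proj (𝕜 := ℝ) i : E3 →L[ℝ] ℝ).hasFDerivAt.comp_hasDerivAt t h

theorem hasDerivAt_of_coord {f : ℝ → E3} {f' : E3} {t : ℝ}
    (h : ∀ i, HasDerivAt (fun x => f x i) (f' i) t) : HasDerivAt f f' t :=
  (PiLp.continuousLinearEquiv 2 ℝ (fun _ : Fin 3 => ℝ)).symm.toContinuousLinearMap.hasFDerivAt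
    |>.comp_hasDerivAt t (hasDerivAt_pi.2 h)

theorem hasDerivAt_cross {a b : ℝ → E3} {a' b' : E3} {t : ℝ} (ha : HasDerivAt a a' t)
    (hb : HasDerivAt b b' t) :
    HasDerivAt (fun x => cross (a x) (b x)) (cross a' (b t) + cross (a t) b') t := by
  refine hasDerivAt_of_coord fun i => ?_
  fin_cases i
  · simp only [Fin.zero_eta, PiLp.add_apply, cross_apply_zero]
    exact (((ha.coord 1).mul (hb.coord 2)).sub ((ha.coord 2).mul (hb.coord 1))).congr_deriv (by ring)
  · simp only [Fin.mk_one, PiLp.add_apply, cross_apply_one]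
    exact (((ha.coord 2).mul (hb.coord 0)).sub ((ha.coord 0).mul (hb.coord 2))).congr_deriv (by ring)
  · simp only [Fin.reduceFinMk, PiLp.add_apply, cross_apply_two]
    exact (((ha.coord 0).mul (hb.coord 1)).sub ((ha.coord 1).mul (hb.coord 0))).congr_deriv (by ring)

theorem inner_cross_left (a b : E3) : inner ℝ (cross a b) a = (0 : ℝ) := by
  rw [inner_eq, cross_apply_zero, cross_apply_one, cross_apply_two]; ring

theorem inner_cross_right (a b : E3) : inner ℝ (cross a b) b = (0 : ℝ) := by
  rw [inner_eq, cross_apply_zero, cross_apply_one, cross_apply_two]; ring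

theorem cross_ne_zero {a b : E3} (h : LinearIndependent ℝ ![a, b]) : cross a b ≠ 0 := by
  intro h0
  have hl : LinearIndependent ℝ ![WithLp.ofLp a, WithLp.ofLp b] := by
    rw [LinearIndependent.pair_iff] at h ⊢
    intro x y hxy
    exact h x y (by ext i; simpa using congrFun hxy i)
  have := crossProduct_ne_zero_iff_linearIndependent.2 hl
  exact this (by simpa [cross] using congrArg WithLp.ofLp h0)

/-- Along a curve of frames `(a, b)`, the unit normal is differentiable, and its derivative is
determined by the derivatives of `a` and `b`. -/
theorem exists_hasDerivAt_normalize_cross {a b : ℝ → E3} {a' b' : E3} {t : ℝ}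
    (ha : HasDerivAt a a' t) (hb : HasDerivAt b b' t) (h : cross (a t) (b t) ≠ 0) :
    ∃ ν' : E3, HasDerivAt (fun x => ‖cross (a x) (b x)‖⁻¹ • cross (a x) (b x)) ν' t ∧
      inner ℝ ν' (‖cross (a t) (b t)‖⁻¹ • cross (a t) (b t)) = (0 : ℝ) ∧
      inner ℝ ν' (a t) = -inner ℝ (‖cross (a t) (b t)‖⁻¹ • cross (a t) (b t)) a' ∧
      inner ℝ ν' (b t) = -inner ℝ (‖cross (a t) (b t)‖⁻¹ • cross (a t) (b t)) b' := by
  have hc := hasDerivAt_cross ha hb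
  set ν : ℝ → E3 := fun x => ‖cross (a x) (b x)‖⁻¹ • cross (a x) (b x) with hν
  have hd : DifferentiableAt ℝ ν t :=
    ((hc.differentiableAt.norm ℝ h).inv (norm_ne_zero_iff.2 h)).smul hc.differentiableAt
  have hν' := hd.hasDerivAt
  -- Weingarten's argument: differentiate a constant product ⟨ν, y⟩. It is used with y = ν, a and b.
  have hzero : ∀ {y : ℝ → E3} {y' : E3}, HasDerivAt y y' t → (∃ k : ℝ, ∀ᶠ x in nhds t,
      inner ℝ (ν x) (y x) = k) → inner ℝ (deriv ν t) (y t) = -inner ℝ (ν t) y' := by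
    rintro y y' hy ⟨k, hk⟩
    have h1 := hν'.inner ℝ hy
    have h2 := (hasDerivAt_const t k).congr_of_eventuallyEq hk
    have := h1.unique h2
    linarith
  refine ⟨deriv ν t, hν', ?_, ?_, ?_⟩
  · have hev : ∀ᶠ x in nhds t, inner ℝ (ν x) (ν x) = (1 : ℝ) := by
      filter_upwards [hc.continuousAt.eventually_ne h] with x hx
      rw [real_inner_self_eq_norm_sq, hν]
      simp [norm_smul, norm_ne_zero_iff.2 hx]
    have := hzero hν' ⟨1, hev⟩
    rw [real_inner_comm (deriv ν t) (ν t)] at this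
    show inner ℝ (deriv ν t) (ν t) = (0 : ℝ)
    linarith
  · exact hzero ha ⟨0, Filter.Eventually.of_forall fun x => by
      simp [hν, inner_smul_left, inner_cross_left]⟩
  · exact hzero hb ⟨0, Filter.Eventually.of_forall fun x => by
      simp [hν, inner_smul_left, inner_cross_right]⟩

theorem inner_e3_right (x : E3) : inner ℝ x e3 = x 2 := by
  simp [inner_eq, e3]

theorem inner_e3_left (x : E3) : inner ℝ e3 x = x 2 := by
  simp [inner_eq, e3]

theorem gradient_dirichletIntegrand {ν : E3} (h : ν 2 ≠ 0) :
    gradient dirichletIntegrand ν = (-(1 / ν 2 ^ 2) - 1) • e3 := by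
  apply HasGradientAt.gradient
  rw [hasGradientAt_iff_hasFDerivAt]
  have hp : HasFDerivAt (fun x : E3 => x 2) (EuclideanSpace.proj (𝕜 := ℝ) 2 : E3 →L[ℝ] ℝ) ν :=
    (EuclideanSpace.proj (𝕜 := ℝ) 2 : E3 →L[ℝ] ℝ).hasFDerivAt
  have hd := ((hasDerivAt_inv h).comp_hasFDerivAt ν hp).sub hp
  have he : dirichletIntegrand = ((fun y => y⁻¹) ∘ fun x : E3 => x 2) - fun x => x 2 := by
    ext x; simp [dirichletIntegrand]
  have hL : (InnerProductSpace.toDual ℝ E3) ((-(1 / ν 2 ^ 2) - 1) • e3)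
      = -(ν 2 ^ 2)⁻¹ • (EuclideanSpace.proj (𝕜 := ℝ) 2 : E3 →L[ℝ] ℝ)
        - (EuclideanSpace.proj (𝕜 := ℝ) 2 : E3 →L[ℝ] ℝ) := by
    ext x
    simp only [InnerProductSpace.toDual_apply_apply, inner_smul_left, inner_e3_left]
    simp
    ring
  rw [he, hL]
  exact hd

theorem sphereGrad_dirichletIntegrand {ν : E3} (h : ν 2 ≠ 0) :
    sphereGrad dirichletIntegrand ν = (-(1 / ν 2 ^ 2) - 1) • (e3 - ν 2 • ν) := by
  rw [sphereGrad, gradient_dirichletIntegrand h, inner_smul_left, inner_e3_left]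
  simp [smul_sub, smul_smul]

theorem hasDerivAt_sphereGrad {ν : ℝ → E3} {ν' : E3} {t : ℝ} (h : HasDerivAt ν ν' t)
    (h0 : ν t 2 ≠ 0) :
    HasDerivAt (fun x => sphereGrad dirichletIntegrand (ν x))
      ((-(1 / ν t 2 ^ 2) - 1) • (-(ν t 2 • ν' + ν' 2 • ν t))
        + (2 * ν' 2 / ν t 2 ^ 3) • (e3 - ν t 2 • ν t)) t := by
  have h2 := h.coord 2
  have hev : (fun x => sphereGrad dirichletIntegrand (ν x)) =ᶠ[nhds t]
      fun x => (-(1 / ν x 2 ^ 2) - 1) • (e3 - ν x 2 • ν x) := by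
    filter_upwards [h2.continuousAt.eventually_ne h0] with x hx
    exact sphereGrad_dirichletIntegrand hx
  refine HasDerivAt.congr_of_eventuallyEq ?_ hev
  have h3 : HasDerivAt (fun x => -(1 / ν x 2 ^ 2) - 1) (2 * ν' 2 / ν t 2 ^ 3) t := by
    have hd := ((((hasDerivAt_pow 2 (ν t 2)).fun_inv (pow_ne_zero 2 h0)).fun_neg).sub_const 1).comp t h2
    have he : (fun x => -(1 / ν x 2 ^ 2) - 1) = (fun y : ℝ => -(y ^ 2)⁻¹ - 1) ∘ fun x => ν x 2 := by
      ext x; simp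
    rw [he]
    refine hd.congr_deriv ?_
    field_simp
    norm_num
    ring
  have h4 : HasDerivAt (fun x => e3 - ν x 2 • ν x) (-(ν t 2 • ν' + ν' 2 • ν t)) t :=
    (h2.smul h).const_sub e3
  exact h3.smul h4

end ParamSurface

/-! ### The curvature equation of the Dirichlet energy in an arbitrary parametrization. -/

namespace ParamSurface

/-- The Sherman–Morrison identity behind the formula for the anisotropic mean curvature. -/
theorem trace_add_quadratic_eq {g11 g12 g22 h11 h12 h22 z1 z2 m1 m2 n W : ℝ}
    (hW : W ≠ 0) (hn : n ≠ 0) (hD : g11 * g22 - g12 ^ 2 = W ^ 2)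
    (hN : (W * n) ^ 2 = (g11 - z1 ^ 2) * (g22 - z2 ^ 2) - (g12 - z1 * z2) ^ 2)
    (hm1 : W ^ 2 * m1 = -((g22 * z1 - g12 * z2) * h11) - (g11 * z2 - g12 * z1) * h12)
    (hm2 : W ^ 2 * m2 = -((g22 * z1 - g12 * z2) * h12) - (g11 * z2 - g12 * z1) * h22) :
    (2 * ((g22 * h11 - 2 * g12 * h12 + g11 * h22) / (2 * (g11 * g22 - g12 ^ 2))) * (1 / n - n)
      - (g22 * ((-(1 / n ^ 2) - 1) * (n * h11) + 2 * m1 / n ^ 3 * z1)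
        - g12 * (((-(1 / n ^ 2) - 1) * (n * h12) + 2 * m1 / n ^ 3 * z2)
          + ((-(1 / n ^ 2) - 1) * (n * h12) + 2 * m2 / n ^ 3 * z1))
        + g11 * ((-(1 / n ^ 2) - 1) * (n * h22) + 2 * m2 / n ^ 3 * z2))
        / (g11 * g22 - g12 ^ 2)) * (W * n) ^ 3
    = 2 * W * (h11 * (g22 - z2 ^ 2) - 2 * h12 * (g12 - z1 * z2) + h22 * (g11 - z1 ^ 2)) := by
  -- Here z is the height and n = ν₃. The hypotheses `hm1`, `hm2` say dn = -h(∇z, ·), and `hN` says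
  -- that the horizontal metric g - dz ⊗ dz has determinant (W n)². The right side is the trace of h
  -- against the adjugate of that metric.
  have key : W ^ 2 * ((g22 * h11 - 2 * g12 * h12 + g11 * h22) * n ^ 2
      - m1 * (g22 * z1 - g12 * z2) - m2 * (g11 * z2 - g12 * z1))
      = W ^ 2 * (h11 * (g22 - z2 ^ 2) - 2 * h12 * (g12 - z1 * z2) + h22 * (g11 - z1 ^ 2)) := by
    linear_combination (g22 * h11 - 2 * g12 * h12 + g11 * h22) * hN
      - (g22 * z1 - g12 * z2) * hm1 - (g11 * z2 - g12 * z1) * hm2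
      + (h11 * (g22 - z2 ^ 2) - 2 * h12 * (g12 - z1 * z2) + h22 * (g11 - z1 ^ 2)) * hD
  have key' := mul_left_cancel₀ (pow_ne_zero 2 hW) key
  rw [hD, mul_assoc, ← key']
  field_simp
  ring

theorem inner_cross_cross (a b : E3) :
    inner ℝ (cross a b) (cross a b)
      = inner ℝ a a * inner ℝ b b - (inner ℝ a b : ℝ) ^ 2 := by
  simp only [inner_eq, cross_apply_zero, cross_apply_one, cross_apply_two]; ring

/-- The decomposition of a vector in the frame `a, b, a × b`. -/
theorem inner_cross_self_smul (a b x : E3) :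
    (inner ℝ (cross a b) (cross a b) : ℝ) • x
      = (inner ℝ x (cross a b) : ℝ) • cross a b
        + (inner ℝ b b * inner ℝ x a - inner ℝ a b * inner ℝ x b : ℝ) • a
        + (inner ℝ a a * inner ℝ x b - inner ℝ a b * inner ℝ x a : ℝ) • b := by
  ext i
  fin_cases i <;>
  · simp only [Fin.zero_eta, Fin.mk_one, Fin.reduceFinMk, PiLp.add_apply, PiLp.smul_apply,
      smul_eq_mul, inner_eq, cross_apply_zero, cross_apply_one, cross_apply_two]
    ring

/-- The anisotropic mean curvature of the Dirichlet energy, multiplied by the cube of the third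
component of `N = X_s × X_θ`, is polynomial in the derivatives of `X`. -/
theorem anisotropicMeanCurvature_dirichlet {X : ℝ → ℝ → E3} {s θ : ℝ} {Xss Xst Xtt : E3}
    (hss : HasDerivAt (fun σ => d1 X σ θ) Xss s) (hst : HasDerivAt (fun τ => d1 X s τ) Xst θ)
    (hts : HasDerivAt (fun σ => d2 X σ θ) Xst s) (htt : HasDerivAt (fun τ => d2 X s τ) Xtt θ)
    (himm : IsImmersedAt X s θ) (h0 : unitNormal X s θ 2 ≠ 0) :
    anisotropicMeanCurvature dirichletIntegrand X s θ * cross (d1 X s θ) (d2 X s θ) 2 ^ 3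
      = 2 * (inner ℝ (cross (d1 X s θ) (d2 X s θ)) Xss * (d2 X s θ 0 ^ 2 + d2 X s θ 1 ^ 2)
        - 2 * inner ℝ (cross (d1 X s θ) (d2 X s θ)) Xst
          * (d1 X s θ 0 * d2 X s θ 0 + d1 X s θ 1 * d2 X s θ 1)
        + inner ℝ (cross (d1 X s θ) (d2 X s θ)) Xtt * (d1 X s θ 0 ^ 2 + d1 X s θ 1 ^ 2)) := by
  have hN := cross_ne_zero himm
  obtain ⟨ν1, hν1, o1, i11, i12⟩ := exists_hasDerivAt_normalize_cross hss hts hN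
  obtain ⟨ν2, hν2, o2, i21, i22⟩ := exists_hasDerivAt_normalize_cross hst htt hN
  have hV1 : d1 (fun σ τ => sphereGrad dirichletIntegrand (unitNormal X σ τ)) s θ = _ :=
    (hasDerivAt_sphereGrad (ν := fun σ => unitNormal X σ θ) hν1 h0).deriv
  have hV2 : d2 (fun σ τ => sphereGrad dirichletIntegrand (unitNormal X σ τ)) s θ = _ :=
    (hasDerivAt_sphereGrad (ν := fun τ => unitNormal X s τ) hν2 h0).deriv
  have dss : d1 (d1 X) s θ = Xss := hss.deriv
  have dst : d2 (d1 X) s θ = Xst := hst.deriv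
  have dtt : d2 (d2 X) s θ = Xtt := htt.deriv
  rw [anisotropicMeanCurvature, surfaceDiv, meanCurvature, detG, dirichletIntegrand, h11, h12, h22,
    hV1, hV2, dss, dst, dtt, g11, g12, g22]
  set a := d1 X s θ
  set b := d2 X s θ
  set N := cross a b with hNdef
  set W := ‖N‖ with hWdef
  have hW : W ≠ 0 := norm_ne_zero_iff.2 hN
  have hν : unitNormal X s θ = W⁻¹ • N := rfl
  rw [← hν] at o1 o2 i11 i12 i21 i22
  set ν := unitNormal X s θ
  have hNν : N = W • ν := by rw [hν, smul_smul, mul_inv_cancel₀ hW, one_smul]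
  have hWW : inner ℝ N N = W ^ 2 := real_inner_self_eq_norm_sq N
  have hνa : inner ℝ ν a = (0 : ℝ) := by rw [hν, inner_smul_left, inner_cross_left, mul_zero]
  have hνb : inner ℝ ν b = (0 : ℝ) := by rw [hν, inner_smul_left, inner_cross_right, mul_zero]
  have hD : inner ℝ a a * inner ℝ b b - (inner ℝ a b : ℝ) ^ 2 = W ^ 2 := by
    rw [← inner_cross_cross, hWW]
  have hN2 : N 2 = W * ν 2 := by rw [hNν]; rfl
  -- The third component of the tangential decomposition of ∂ν expresses dν₃ through the second
  -- fundamental form.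
  have hm1 := congrArg (fun x : E3 => x 2) (inner_cross_self_smul a b ν1)
  have hm2 := congrArg (fun x : E3 => x 2) (inner_cross_self_smul a b ν2)
  simp only [PiLp.add_apply, PiLp.smul_apply, smul_eq_mul] at hm1 hm2
  rw [← hNdef, hWW, hNν, inner_smul_right, o1, i11, i12] at hm1
  rw [← hNdef, hWW, hNν, inner_smul_right, o2, i21, i22] at hm2
  -- N₃ is the Jacobian of the projection to the xy-plane, so its square is the Gram determinant of
  -- the projected tangent vectors.
  have hg : (W * ν 2) ^ 2 = (inner ℝ a a - a 2 ^ 2) * (inner ℝ b b - b 2 ^ 2)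
      - (inner ℝ a b - a 2 * b 2 : ℝ) ^ 2 := by
    rw [← hN2, hNdef, cross_apply_two]
    simp only [inner_eq]
    ring
  have main := trace_add_quadratic_eq (m1 := ν1 2) (m2 := ν2 2) (h11 := inner ℝ ν Xss)
    (h12 := inner ℝ ν Xst) (h22 := inner ℝ ν Xtt) hW h0 hD hg
    (by linear_combination hm1) (by linear_combination hm2)
  have hmet : ∀ x y : E3, x 0 * y 0 + x 1 * y 1 = inner ℝ x y - x 2 * y 2 := fun x y => by
    rw [inner_eq]; ring
  have e1 : b 0 ^ 2 + b 1 ^ 2 = inner ℝ b b - b 2 ^ 2 := by rw [inner_eq]; ring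
  have e2 : a 0 ^ 2 + a 1 ^ 2 = inner ℝ a a - a 2 ^ 2 := by rw [inner_eq]; ring
  rw [e1, e2, hmet a b, hN2]
  simp only [inner_add_left, inner_smul_left, inner_neg_left, inner_sub_left, inner_e3_left, hνa,
    hνb, i11, i12, i21, i22, conj_trivial, hNν]
  refine Eq.trans ?_ (main.trans ?_)
  · congr 1
    ring
  · ring

end ParamSurface

/-! ### Trigonometric polynomials as polynomials on the unit circle -/

section TrigPolynomial

open Polynomial

/-- The polynomial that takes the value `w * (f₀ + f₁ cos θ + f₂ sin θ)` at `w = exp (i θ)`. -/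
noncomputable def circlePoly (f0 f1 f2 : ℝ) : ℂ[X] :=
  C (f0 : ℂ) * X + C (((f1 : ℂ) - Complex.I * f2) / 2) * X ^ 2
    + C (((f1 : ℂ) + Complex.I * f2) / 2)

theorem eval_zero_circlePoly (f0 f1 f2 : ℝ) :
    (circlePoly f0 f1 f2).eval 0 = ((f1 : ℂ) + Complex.I * f2) / 2 := by
  simp [circlePoly]

theorem eval_circlePoly (f0 f1 f2 θ : ℝ) :
    (circlePoly f0 f1 f2).eval ((Real.cos θ : ℂ) + Real.sin θ * Complex.I)
      = ((Real.cos θ : ℂ) + Real.sin θ * Complex.I)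
        * (f0 + f1 * (Real.cos θ : ℂ) + f2 * (Real.sin θ : ℂ)) := by
  have h : ((Real.cos θ : ℝ) : ℂ) ^ 2 + ((Real.sin θ : ℝ) : ℂ) ^ 2 = 1 := by
    exact_mod_cast Real.cos_sq_add_sin_sq θ
  simp only [circlePoly, eval_add, eval_mul, eval_C, eval_X, eval_pow]
  linear_combination (((f1 : ℂ) + Complex.I * f2) / 2) * (-h)
    + (((Real.sin θ : ℝ) : ℂ) ^ 2 * (f1 - Complex.I * f2) / 2
      - Real.cos θ * Real.sin θ * f2) * Complex.I_sq

/-- X Q - k R³ vanishes at infinitely many points of the unit circle, hence identically, and its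
value at 0 is -k R(0)³. The factor X records that one side has lower trigonometric degree than the
cube could have; R(0) is the extreme Fourier coefficient. -/
theorem eval_zero_eq_zero_of_circle {k : ℝ} (hk : k ≠ 0) {Q R : ℂ[X]}
    (h : ∀ θ : ℝ, ((Real.cos θ : ℂ) + Real.sin θ * Complex.I)
        * Q.eval ((Real.cos θ : ℂ) + Real.sin θ * Complex.I)
      = k * R.eval ((Real.cos θ : ℂ) + Real.sin θ * Complex.I) ^ 3) :
    R.eval 0 = 0 := by
  have hz : X * Q - C (k : ℂ) * R ^ 3 = 0 := by
    apply eq_zero_of_infinite_isRoot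
    refine Set.infinite_of_injOn_mapsTo
      (f := fun θ : ℝ => (Real.cos θ : ℂ) + Real.sin θ * Complex.I) (s := Set.Icc 0 Real.pi)
      ?_ ?_ (Set.Icc_infinite Real.pi_pos)
    · intro x hx y hy hxy
      apply Real.injOn_cos hx hy
      simpa only [Complex.add_re, Complex.ofReal_re, Complex.re_ofReal_mul, Complex.I_re,
        mul_zero, add_zero] using congrArg Complex.re hxy
    · intro θ _
      simp only [Set.mem_ofPred_eq, IsRoot.def, eval_sub, eval_mul, eval_X, eval_C, eval_pow, h θ,
        sub_self]
  have h0 := congrArg (eval 0) hz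
  simpa [hk] using h0

end TrigPolynomial

/-! ### Comparison of Fourier coefficients along a circle. -/

namespace ParamSurface

open Polynomial

/-- If the equation of constant anisotropic mean curvature holds along a circle, the second
Fourier coefficient of the third component of `X_s × X_θ` vanishes. -/
theorem cross_fourier_eq_zero {k : ℝ} (hk : k ≠ 0) {p q c' p' q' c'' p'' q'' : E3}
    (h : ∀ θ : ℝ, ∀ C S : ℝ, C = Real.cos θ → S = Real.sin θ → ∀ a b : E3,
      a = c' + (C • p' + S • q') → b = C • q - S • p →
      k * cross a b 2 ^ 3
        = inner ℝ (cross a b) (c'' + (C • p'' + S • q'')) * (b 0 ^ 2 + b 1 ^ 2)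
          - 2 * inner ℝ (cross a b) (C • q' - S • p') * (a 0 * b 0 + a 1 * b 1)
          + inner ℝ (cross a b) (-(C • p + S • q)) * (a 0 ^ 2 + a 1 ^ 2)) :
    cross p' p 2 = cross q' q 2 ∧ cross p' q 2 + cross q' p 2 = 0 := by
  let a (i : Fin 3) : ℂ[X] := circlePoly (c' i) (p' i) (q' i)
  let b (i : Fin 3) : ℂ[X] := circlePoly 0 (q i) (-p i)
  let N0 : ℂ[X] := a 1 * b 2 - a 2 * b 1
  let N1 : ℂ[X] := a 2 * b 0 - a 0 * b 2
  let N2 : ℂ[X] := a 0 * b 1 - a 1 * b 0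
  let A (i : Fin 3) : ℂ[X] := circlePoly (c'' i) (p'' i) (q'' i)
  let B (i : Fin 3) : ℂ[X] := circlePoly 0 (q' i) (-p' i)
  let G (i : Fin 3) : ℂ[X] := circlePoly 0 (-p i) (-q i)
  -- On the circle the polynomial N2 takes the value w² N₃ and Q is w⁵ times the right side of the
  -- equation, so w Q = k N2³ there. The term with `B` is subtracted twice to account for its factor
  -- 2.
  have hR : N2.eval 0 = 0 := by
    refine eval_zero_eq_zero_of_circle hk
      (Q := (N0 * A 0 + N1 * A 1 + N2 * A 2) * (b 0 ^ 2 + b 1 ^ 2)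
        - (N0 * B 0 + N1 * B 1 + N2 * B 2) * (a 0 * b 0 + a 1 * b 1)
        - (N0 * B 0 + N1 * B 1 + N2 * B 2) * (a 0 * b 0 + a 1 * b 1)
        + (N0 * G 0 + N1 * G 1 + N2 * G 2) * (a 0 ^ 2 + a 1 ^ 2)) fun θ => ?_
    have hθ := congrArg (fun x : ℝ => (x : ℂ)) (h θ _ _ rfl rfl _ _ rfl rfl)
    simp only [inner_eq, cross_apply_zero, cross_apply_one, cross_apply_two, PiLp.add_apply,
      PiLp.sub_apply, PiLp.neg_apply, PiLp.smul_apply, smul_eq_mul, Complex.ofReal_add,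
      Complex.ofReal_sub, Complex.ofReal_mul, Complex.ofReal_pow, Complex.ofReal_neg,
      Complex.ofReal_ofNat] at hθ
    simp only [N0, N1, N2, a, b, A, B, G, eval_add, eval_sub, eval_mul, eval_pow,
      eval_circlePoly, Complex.ofReal_neg, Complex.ofReal_zero]
    generalize (Real.cos θ : ℂ) + Real.sin θ * Complex.I = w
    generalize (Real.cos θ : ℂ) = x at *
    generalize (Real.sin θ : ℂ) = y at *
    linear_combination (-w ^ 6) * hθ
  -- At 0 the factors are (p' + i q')/2 and (q - i p)/2 = -i (p + i q)/2. The two claims are the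
  -- imaginary and real parts of the vanishing of ((p' + i q') × (p + i q))₃.
  simp only [N2, a, b, eval_sub, eval_mul, eval_zero_circlePoly] at hR
  have hre := congrArg Complex.re hR
  have him := congrArg Complex.im hR
  simp at hre him
  rw [cross_apply_two, cross_apply_two, cross_apply_two, cross_apply_two]
  constructor
  · linarith
  · linarith

/-- A trigonometric polynomial of degree one whose cube has degree at most two is constant. -/
theorem eq_zero_of_cube_eq_quadratic {k A B D e0 e1 e2 e3 e4 e5 : ℝ} (hk : k ≠ 0)
    (h : ∀ θ : ℝ, ∀ x y : ℝ, x = Real.cos θ → y = Real.sin θ →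
      k * (D + A * x + B * y) ^ 3
        = e0 + e1 * x + e2 * y + e3 * x ^ 2 + e4 * x * y + e5 * y ^ 2) :
    A = 0 ∧ B = 0 := by
  have hR : (circlePoly D A B).eval 0 = 0 := by
    -- Q is w² times the quadratic side: the affine terms get one extra factor w, the quadratic ones
    -- are products of two factors of degree one.
    refine eval_zero_eq_zero_of_circle hk
      (Q := circlePoly e0 e1 e2 * X + circlePoly 0 e3 e4 * circlePoly 0 1 0
        + circlePoly 0 0 e5 * circlePoly 0 0 1) fun θ => ?_
    have hθ := congrArg (fun x : ℝ => (x : ℂ)) (h θ _ _ rfl rfl)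
    simp only [Complex.ofReal_add, Complex.ofReal_mul, Complex.ofReal_pow] at hθ
    simp only [eval_add, eval_mul, eval_X, eval_circlePoly, Complex.ofReal_zero,
      Complex.ofReal_one]
    generalize (Real.cos θ : ℂ) + Real.sin θ * Complex.I = w
    linear_combination (-w ^ 3) * hθ
  rw [eval_zero_circlePoly] at hR
  have hre := congrArg Complex.re hR
  have him := congrArg Complex.im hR
  simp at hre him
  exact ⟨hre, him⟩

end ParamSurface

/-! ### Differentiating constant components and inner products, and orthonormal frames. -/

open ParamSurface

theorem and_eq_zero_of_sq_add_sq {x y : ℝ} (h : x ^ 2 + y ^ 2 = 0) : x = 0 ∧ y = 0 := by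
  simpa using (add_eq_zero_iff_of_nonneg (sq_nonneg x) (sq_nonneg y)).1 h

theorem ContDiffOn.hasDerivAt_deriv {f : ℝ → E3} {I : Set ℝ} (hI : IsOpen I)
    (hf : ContDiffOn ℝ ∞ f I) {s : ℝ} (hs : s ∈ I) : HasDerivAt f (deriv f s) s :=
  ((hf.differentiableOn (by simp)).differentiableAt (hI.mem_nhds hs)).hasDerivAt

theorem HasDerivAt.apply_eq_zero {f : ℝ → E3} {f' : E3} {I : Set ℝ} (hI : IsOpen I)
    {s : ℝ} (hs : s ∈ I) (hf : HasDerivAt f f' s) {i : Fin 3} (h0 : ∀ t ∈ I, f t i = 0) :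
    f' i = 0 := by
  refine (hf.coord i).unique ((hasDerivAt_const s (0 : ℝ)).congr_of_eventuallyEq ?_)
  filter_upwards [hI.mem_nhds hs] with t ht using h0 t ht

theorem HasDerivAt.inner_eq_neg {f g : ℝ → E3} {f' g' : E3} {I : Set ℝ} (hI : IsOpen I)
    {s k : ℝ} (hs : s ∈ I) (hf : HasDerivAt f f' s) (hg : HasDerivAt g g' s)
    (h0 : ∀ t ∈ I, Inner.inner ℝ (f t) (g t) = k) :
    Inner.inner ℝ f' (g s) = -(Inner.inner ℝ g' (f s) : ℝ) := by
  have h1 := hf.inner ℝ hg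
  have h2 : HasDerivAt (fun t => Inner.inner ℝ (f t) (g t)) 0 s := by
    refine (hasDerivAt_const s k).congr_of_eventuallyEq ?_
    filter_upwards [hI.mem_nhds hs] with t ht using h0 t ht
  have := h1.unique h2
  rw [real_inner_comm g' (f s)] at *
  linarith

namespace ParamSurface

theorem span_pair_eq_orthogonal_cross {u v : E3} (huu : inner ℝ u u = (1 : ℝ))
    (hvv : inner ℝ v v = (1 : ℝ)) (huv : inner ℝ u v = (0 : ℝ)) :
    Submodule.span ℝ {u, v} = (Submodule.span ℝ {cross u v})ᗮ := by
  apply le_antisymm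
  · rw [Submodule.span_le]
    rintro x (rfl | rfl) <;> rw [SetLike.mem_coe, Submodule.mem_orthogonal_singleton_iff_inner_right]
    · exact inner_cross_left _ _
    · exact inner_cross_right _ _
  · intro x hx
    rw [Submodule.mem_orthogonal_singleton_iff_inner_left] at hx
    have h := inner_cross_self_smul u v x
    rw [inner_cross_cross, huu, hvv, huv, hx] at h
    norm_num at h
    rw [h, Submodule.mem_span_pair]
    exact ⟨_, _, rfl⟩

theorem eq_sum_of_orthonormal {u v : E3} (huu : inner ℝ u u = (1 : ℝ))
    (hvv : inner ℝ v v = (1 : ℝ)) (huv : inner ℝ u v = (0 : ℝ)) (x : E3) :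
    x = (inner ℝ x (cross u v) : ℝ) • cross u v + (inner ℝ x u : ℝ) • u
      + (inner ℝ x v : ℝ) • v := by
  have h := inner_cross_self_smul u v x
  rw [inner_cross_cross, huu, hvv, huv] at h
  norm_num at h
  exact h

end ParamSurface

/-! ### Cyclic surfaces and the parallelism of their planes. -/

namespace CyclicSurface

variable (S : CyclicSurface)

/-- The radius vector at `θ = 0`. -/
def p (s : ℝ) : E3 := S.r s • S.u s

/-- The radius vector at `θ = π / 2`. -/
def q (s : ℝ) : E3 := S.r s • S.v s

/-- The unit normal of the plane of the circle. -/
def n (s : ℝ) : E3 := cross (S.u s) (S.v s)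

theorem X_eq (s θ : ℝ) : S.X s θ = S.c s + (Real.cos θ • S.p s + Real.sin θ • S.q s) := by
  simp only [X, p, q, smul_add, smul_comm (S.r s)]

theorem smooth_p : ContDiffOn ℝ ∞ S.p S.I := S.smooth_r.smul S.smooth_u

theorem smooth_q : ContDiffOn ℝ ∞ S.q S.I := S.smooth_r.smul S.smooth_v

theorem inner_u_u {s : ℝ} (hs : s ∈ S.I) : inner ℝ (S.u s) (S.u s) = (1 : ℝ) := by
  have h : ‖S.u s‖ = 1 := (S.orthonormal s hs).1 0
  rw [real_inner_self_eq_norm_sq, h, one_pow]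

theorem inner_v_v {s : ℝ} (hs : s ∈ S.I) : inner ℝ (S.v s) (S.v s) = (1 : ℝ) := by
  have h : ‖S.v s‖ = 1 := (S.orthonormal s hs).1 1
  rw [real_inner_self_eq_norm_sq, h, one_pow]

theorem inner_u_v {s : ℝ} (hs : s ∈ S.I) : inner ℝ (S.u s) (S.v s) = (0 : ℝ) := by
  simpa using (S.orthonormal s hs).2 (i := 0) (j := 1) (by decide)

theorem inner_n_n {s : ℝ} (hs : s ∈ S.I) : inner ℝ (S.n s) (S.n s) = (1 : ℝ) := by
  rw [n, inner_cross_cross, S.inner_u_u hs, S.inner_v_v hs, S.inner_u_v hs]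
  norm_num

theorem d2_X (s θ : ℝ) : d2 S.X s θ = Real.cos θ • S.q s - Real.sin θ • S.p s := by
  have h := ((((Real.hasDerivAt_cos θ).smul_const (S.p s)).add
    ((Real.hasDerivAt_sin θ).smul_const (S.q s))).const_add (S.c s)).deriv
  have he : (fun τ => S.X s τ) = fun τ => S.c s + (Real.cos τ • S.p s + Real.sin τ • S.q s) :=
    funext fun τ => S.X_eq s τ
  rw [d2, he]
  refine h.trans ?_
  rw [neg_smul]
  abel

variable {S}

theorem hasDerivAt_combination {f g h : ℝ → E3} {f' g' h' : E3} {s : ℝ} (hf : HasDerivAt f f' s)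
    (hg : HasDerivAt g g' s) (hh : HasDerivAt h h' s) (x y : ℝ) :
    HasDerivAt (fun σ => f σ + (x • g σ + y • h σ)) (f' + (x • g' + y • h')) s :=
  hf.add ((hg.const_smul x).add (hh.const_smul y))

theorem d1_X {s : ℝ} (hs : s ∈ S.I) (θ : ℝ) :
    d1 S.X s θ = deriv S.c s + (Real.cos θ • deriv S.p s + Real.sin θ • deriv S.q s) := by
  have he : (fun σ => S.X σ θ) = fun σ => S.c σ + (Real.cos θ • S.p σ + Real.sin θ • S.q σ) :=
    funext fun σ => S.X_eq σ θ
  rw [d1, he]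
  exact (hasDerivAt_combination (S.smooth_c.hasDerivAt_deriv S.isOpen_I hs)
    (S.smooth_p.hasDerivAt_deriv S.isOpen_I hs) (S.smooth_q.hasDerivAt_deriv S.isOpen_I hs)
    _ _).deriv

/-- The equation of constant anisotropic mean curvature in terms of the curves `c`, `p`, `q`. -/
theorem IsDirichletCAMC.equation {Λ : ℝ} (hS : S.IsDirichletCAMC Λ) {s : ℝ} (hs : s ∈ S.I)
    (θ x y : ℝ) (hx : x = Real.cos θ) (hy : y = Real.sin θ) (a b : E3)
    (ha : a = deriv S.c s + (x • deriv S.p s + y • deriv S.q s))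
    (hb : b = x • S.q s - y • S.p s) :
    Λ / 2 * cross a b 2 ^ 3
      = inner ℝ (cross a b) (deriv (deriv S.c) s
          + (x • deriv (deriv S.p) s + y • deriv (deriv S.q) s)) * (b 0 ^ 2 + b 1 ^ 2)
        - 2 * inner ℝ (cross a b) (x • deriv S.q s - y • deriv S.p s)
          * (a 0 * b 0 + a 1 * b 1)
        + inner ℝ (cross a b) (-(x • S.p s + y • S.q s)) * (a 0 ^ 2 + a 1 ^ 2) := by
  have hI := S.isOpen_I
  have hdc := S.smooth_c.deriv_of_isOpen hI (m := ∞) (by simp)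
  have hdp := S.smooth_p.deriv_of_isOpen hI (m := ∞) (by simp)
  have hdq := S.smooth_q.deriv_of_isOpen hI (m := ∞) (by simp)
  subst hx hy
  have hss : HasDerivAt (fun σ => d1 S.X σ θ) (deriv (deriv S.c) s
      + (Real.cos θ • deriv (deriv S.p) s + Real.sin θ • deriv (deriv S.q) s)) s := by
    refine (hasDerivAt_combination (hdc.hasDerivAt_deriv hI hs) (hdp.hasDerivAt_deriv hI hs)
      (hdq.hasDerivAt_deriv hI hs) _ _).congr_of_eventuallyEq ?_
    filter_upwards [hI.mem_nhds hs] with σ hσ using d1_X hσ θ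
  have hst : HasDerivAt (fun τ => d1 S.X s τ)
      (Real.cos θ • deriv S.q s - Real.sin θ • deriv S.p s) θ := by
    simp only [d1_X hs]
    refine ((((Real.hasDerivAt_cos θ).smul_const (deriv S.p s)).add
      ((Real.hasDerivAt_sin θ).smul_const (deriv S.q s))).const_add (deriv S.c s)).congr_deriv ?_
    rw [neg_smul]
    abel
  have hts : HasDerivAt (fun σ => d2 S.X σ θ)
      (Real.cos θ • deriv S.q s - Real.sin θ • deriv S.p s) s := by
    simp only [d2_X]
    exact ((S.smooth_q.hasDerivAt_deriv hI hs).const_smul (Real.cos θ)).sub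
      ((S.smooth_p.hasDerivAt_deriv hI hs).const_smul (Real.sin θ))
  have htt : HasDerivAt (fun τ => d2 S.X s τ)
      (-(Real.cos θ • S.p s + Real.sin θ • S.q s)) θ := by
    simp only [d2_X]
    refine (((Real.hasDerivAt_cos θ).smul_const (S.q s)).sub
      ((Real.hasDerivAt_sin θ).smul_const (S.p s))).congr_deriv ?_
    rw [neg_smul]
    abel
  have h := anisotropicMeanCurvature_dirichlet hss hst hts htt (S.immersed s hs θ) (hS s hs θ).1
  rw [(hS s hs θ).2, d1_X hs, d2_X, ← ha, ← hb] at h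
  linear_combination h / 2

theorem IsDirichletCAMC.cross_eq {Λ : ℝ} (hΛ : Λ ≠ 0) (hS : S.IsDirichletCAMC Λ) {s : ℝ}
    (hs : s ∈ S.I) :
    cross (deriv S.p s) (S.p s) 2 = cross (deriv S.q s) (S.q s) 2 ∧
      cross (deriv S.p s) (S.q s) 2 + cross (deriv S.q s) (S.p s) 2 = 0 :=
  cross_fourier_eq_zero (div_ne_zero hΛ two_ne_zero) (hS.equation hs)

/-- The derivative of the normal of the planes of the foliation. It vanishes unless the plane is
horizontal. -/
theorem IsDirichletCAMC.exists_hasDerivAt_n {Λ : ℝ} (hΛ : Λ ≠ 0) (hS : S.IsDirichletCAMC Λ)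
    {s : ℝ} (hs : s ∈ S.I) :
    ∃ n' : E3, HasDerivAt S.n n' s ∧ n' 2 = 0 ∧ (n' = 0 ∨ S.u s 2 ^ 2 + S.v s 2 ^ 2 = 0) := by
  have hI := S.isOpen_I
  have hu := S.smooth_u.hasDerivAt_deriv hI hs
  have hv := S.smooth_v.hasDerivAt_deriv hI hs
  have hr : HasDerivAt S.r (deriv S.r s) s :=
    ((S.smooth_r.differentiableOn (by simp)).differentiableAt (hI.mem_nhds hs)).hasDerivAt
  have hp : deriv S.p s = S.r s • deriv S.u s + deriv S.r s • S.u s := (hr.smul hu).deriv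
  have hq : deriv S.q s = S.r s • deriv S.v s + deriv S.r s • S.v s := (hr.smul hv).deriv
  have hn : HasDerivAt S.n _ s := hasDerivAt_cross hu hv
  have huu := S.inner_u_u hs
  have hvv := S.inner_v_v hs
  have huv := S.inner_u_v hs
  have duu := hu.inner_eq_neg hI hs hu fun t ht => S.inner_u_u ht
  have dvv := hv.inner_eq_neg hI hs hv fun t ht => S.inner_v_v ht
  have duv := hu.inner_eq_neg hI hs hv fun t ht => S.inner_u_v ht
  have dnn := hn.inner_eq_neg hI hs hn fun t ht => S.inner_n_n ht
  have dnu := hn.inner_eq_neg hI hs hu fun t _ => inner_cross_left (S.u t) (S.v t)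
  have dnv := hn.inner_eq_neg hI hs hv fun t _ => inner_cross_right (S.u t) (S.v t)
  have hdec := eq_sum_of_orthonormal huu hvv huv
  have eu := hdec (deriv S.u s)
  have ev := hdec (deriv S.v s)
  have en := hdec (cross (deriv S.u s) (S.v s) + cross (S.u s) (deriv S.v s))
  obtain ⟨h1, h2⟩ := hS.cross_eq hΛ hs
  have hr0 := (S.r_pos s hs).ne'
  refine ⟨_, hn, ?_⟩
  change inner ℝ _ (cross (S.u s) (S.v s)) = -inner ℝ _ (cross (S.u s) (S.v s)) at dnn
  change inner ℝ _ (S.u s) = -inner ℝ _ (cross (S.u s) (S.v s)) at dnu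
  change inner ℝ _ (S.v s) = -inner ℝ _ (cross (S.u s) (S.v s)) at dnv
  generalize cross (deriv S.u s) (S.v s) + cross (S.u s) (deriv S.v s) = n' at *
  rw [hp, hq, p, q] at h1 h2
  have duu0 : inner ℝ (deriv S.u s) (S.u s) = (0 : ℝ) := by linarith
  have dvv0 : inner ℝ (deriv S.v s) (S.v s) = (0 : ℝ) := by linarith
  have dnn0 : inner ℝ n' (cross (S.u s) (S.v s)) = (0 : ℝ) := by linarith
  rw [duu0, duv] at eu
  rw [dvv0] at ev
  rw [dnn0, dnu, dnv] at en
  -- With m = u × v the frame equations are u' = α m - w v, v' = β m + w u and n' = -α u - β v.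
  generalize inner ℝ (deriv S.u s) (cross (S.u s) (S.v s)) = α at *
  generalize inner ℝ (deriv S.v s) (cross (S.u s) (S.v s)) = β at *
  generalize inner ℝ (deriv S.v s) (S.u s) = w at *
  rw [eu, ev] at h1 h2
  have hnu : cross (cross (S.u s) (S.v s)) (S.u s) 2 = S.v s 2 := by
    have : cross (cross (S.u s) (S.v s)) (S.u s) 2
        = S.v s 2 * inner ℝ (S.u s) (S.u s) - S.u s 2 * inner ℝ (S.u s) (S.v s) := by
      simp only [inner_eq, cross_apply_zero, cross_apply_one, cross_apply_two]; ring
    rw [this, huu, huv]; ring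
  have hnv : cross (cross (S.u s) (S.v s)) (S.v s) 2 = -S.u s 2 := by
    have : cross (cross (S.u s) (S.v s)) (S.v s) 2
        = S.v s 2 * inner ℝ (S.u s) (S.v s) - S.u s 2 * inner ℝ (S.v s) (S.v s) := by
      simp only [inner_eq, cross_apply_zero, cross_apply_one, cross_apply_two]; ring
    rw [this, hvv, huv]; ring
  rw [cross_apply_two] at hnu hnv
  generalize cross (S.u s) (S.v s) = m at *
  simp only [cross_apply_two, PiLp.add_apply, PiLp.smul_apply, smul_eq_mul] at h1 h2
  -- The parts of p' + i q' in the plane add up to a multiple of u + i v, so they drop out of the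
  -- cross product with p + i q. Only the α and β terms remain: `k1` and `k2` are the real and
  -- imaginary parts of (α + i β)(v₃ - i u₃) = 0.
  have k1 : α * S.v s 2 + β * S.u s 2 = 0 := by
    refine (mul_eq_zero.1 (?_ : S.r s ^ 2 * _ = 0)).resolve_left (pow_ne_zero 2 hr0)
    linear_combination h1 - S.r s ^ 2 * α * hnu + S.r s ^ 2 * β * hnv
  have k2 : β * S.v s 2 - α * S.u s 2 = 0 := by
    refine (mul_eq_zero.1 (?_ : S.r s ^ 2 * _ = 0)).resolve_left (pow_ne_zero 2 hr0)
    linear_combination h2 - S.r s ^ 2 * α * hnv - S.r s ^ 2 * β * hnu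
  have k3 : (α ^ 2 + β ^ 2) * (S.u s 2 ^ 2 + S.v s 2 ^ 2) = 0 := by
    linear_combination (α * S.v s 2 + β * S.u s 2) * k1 + (β * S.v s 2 - α * S.u s 2) * k2
  rcases mul_eq_zero.1 k3 with h0 | h0
  · obtain ⟨hα, hβ⟩ := and_eq_zero_of_sq_add_sq h0
    have hn0 : n' = 0 := by rw [en, hα, hβ]; simp
    exact ⟨by rw [hn0]; rfl, Or.inl hn0⟩
  · obtain ⟨hu2, hv2⟩ := and_eq_zero_of_sq_add_sq h0
    refine ⟨?_, Or.inr h0⟩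
    rw [en]
    simp [hu2, hv2]

theorem eq_of_hasDerivAt_zero {E : Type*} [NormedAddCommGroup E] [NormedSpace ℝ E] {f : ℝ → E}
    (hf : ∀ s ∈ S.I, HasDerivAt f 0 s) {s t : ℝ} (hs : s ∈ S.I) (ht : t ∈ S.I) : f s = f t :=
  S.isOpen_I.is_const_of_deriv_eq_zero S.ordConnected_I.isPreconnected
    (fun x hx => (hf x hx).differentiableAt.differentiableWithinAt) (fun x hx => (hf x hx).deriv)
    hs ht

/-- The alternative in `exists_hasDerivAt_n` depends on s. It becomes uniform because n₃ is constant
and u₃² + v₃² = 1 - n₃²: if this constant is 0 then n = n₃ e₃ throughout, and otherwise n' = 0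
throughout. -/
theorem IsDirichletCAMC.n_eq {Λ : ℝ} (hΛ : Λ ≠ 0) (hS : S.IsDirichletCAMC Λ)
    {s t : ℝ} (hs : s ∈ S.I) (ht : t ∈ S.I) : S.n s = S.n t := by
  have hn2 : ∀ x ∈ S.I, S.n x 2 = S.n s 2 := fun x hx => by
    refine eq_of_hasDerivAt_zero (f := fun y => S.n y 2) (fun y hy => ?_) hx hs
    obtain ⟨n', hn', h2, -⟩ := hS.exists_hasDerivAt_n hΛ hy
    exact h2 ▸ hn'.coord 2
  have hdec : ∀ x ∈ S.I, e3 = S.n x 2 • S.n x + S.u x 2 • S.u x + S.v x 2 • S.v x :=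
    fun x hx => by
      have := eq_sum_of_orthonormal (S.inner_u_u hx) (S.inner_v_v hx) (S.inner_u_v hx) e3
      rw [inner_e3_left, inner_e3_left, inner_e3_left] at this
      exact this
  have hsq : ∀ x ∈ S.I, S.u x 2 ^ 2 + S.v x 2 ^ 2 = 1 - S.n s 2 ^ 2 := fun x hx => by
    have := congrArg (fun y : E3 => y 2) (hdec x hx)
    simp [e3] at this
    rw [← hn2 x hx]
    linarith
  by_cases h1 : 1 - S.n s 2 ^ 2 = 0
  · have key : ∀ x ∈ S.I, S.n x = S.n s 2 • e3 := fun x hx => by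
      have h0 := hsq x hx
      rw [h1] at h0
      obtain ⟨hu2, hv2⟩ := and_eq_zero_of_sq_add_sq h0
      rw [hdec x hx, hu2, hv2, hn2 x hx, zero_smul, zero_smul, add_zero, add_zero, smul_smul,
        show S.n s 2 * S.n s 2 = 1 by linarith, one_smul]
    rw [key s hs, key t ht]
  · refine eq_of_hasDerivAt_zero (fun y hy => ?_) hs ht
    obtain ⟨n', hn', -, h2⟩ := hS.exists_hasDerivAt_n hΛ hy
    rcases h2 with h2 | h2
    · exact h2 ▸ hn'
    · exact absurd (hsq y hy ▸ h2) h1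

theorem IsDirichletCAMC.parallel {Λ : ℝ} (hΛ : Λ ≠ 0) (hS : S.IsDirichletCAMC Λ)
    {s t : ℝ} (hs : s ∈ S.I) (ht : t ∈ S.I) : (S.plane s).Parallel (S.plane t) := by
  rw [AffineSubspace.parallel_iff_direction_eq_and_eq_bot_iff_eq_bot]
  have hne : ∀ x, S.plane x ≠ ⊥ := fun x h => by
    have : S.c x ∈ S.plane x := AffineSubspace.self_mem_mk' _ _
    rw [h] at this
    exact this
  refine ⟨?_, by simp [hne]⟩
  rw [plane, plane, AffineSubspace.direction_mk', AffineSubspace.direction_mk',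
    span_pair_eq_orthogonal_cross (S.inner_u_u hs) (S.inner_v_v hs) (S.inner_u_v hs),
    span_pair_eq_orthogonal_cross (S.inner_u_u ht) (S.inner_v_v ht) (S.inner_u_v ht)]
  have := hS.n_eq hΛ hs ht
  rw [n, n] at this
  rw [this]

end CyclicSurface

/-! ### Horizontal circles: the velocity of the centres. -/

namespace ParamSurface

/-- If a family of horizontal circles satisfies the equation of constant anisotropic mean
curvature, the horizontal velocity of the centres vanishes. -/
theorem horizontal_velocity_eq_zero {k r : ℝ} (hk : k ≠ 0) (hr : r ≠ 0)
    {p q c' p' q' c'' p'' q'' : E3}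
    (h : ∀ θ : ℝ, ∀ x y : ℝ, x = Real.cos θ → y = Real.sin θ → ∀ a b : E3,
      a = c' + (x • p' + y • q') → b = x • q - y • p →
      k * cross a b 2 ^ 3
        = inner ℝ (cross a b) (c'' + (x • p'' + y • q'')) * (b 0 ^ 2 + b 1 ^ 2)
          - 2 * inner ℝ (cross a b) (x • q' - y • p') * (a 0 * b 0 + a 1 * b 1)
          + inner ℝ (cross a b) (-(x • p + y • q)) * (a 0 ^ 2 + a 1 ^ 2))
    (hp : p 2 = 0) (hq : q 2 = 0) (hp' : p' 2 = 0) (hq' : q' 2 = 0) (hp'' : p'' 2 = 0)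
    (hq'' : q'' 2 = 0) (hpp : inner ℝ p p = r ^ 2) (hqq : inner ℝ q q = r ^ 2)
    (hpq : inner ℝ p q = (0 : ℝ)) : c' 0 = 0 ∧ c' 1 = 0 := by
  obtain ⟨h1, h2⟩ := cross_fourier_eq_zero hk h
  rw [inner_eq, hp, hq] at hpq
  rw [inner_eq, hp] at hpp
  rw [inner_eq, hq] at hqq
  rw [cross_apply_two, cross_apply_two] at h1 h2
  -- D, A, B are the Fourier coefficients of N₃, and e0, …, e5 come from expanding the right side.
  -- Its degree falls to 2 because b has constant length r and the horizontal part of N is c'₃ times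
  -- b turned by a right angle, so that N·X_sθ and N·X_θθ do not depend on θ.
  obtain ⟨hA, hB⟩ := eq_zero_of_cube_eq_quadratic (k := k)
    (A := c' 0 * q 1 - c' 1 * q 0) (B := c' 1 * p 0 - c' 0 * p 1) (D := p' 0 * q 1 - p' 1 * q 0)
    (e0 := r ^ 2 * c'' 2 * (p' 0 * q 1 - p' 1 * q 0)
      + c' 2 * (p 0 * q 1 - p 1 * q 0) * (c' 0 ^ 2 + c' 1 ^ 2))
    (e1 := r ^ 2 * c'' 2 * (c' 0 * q 1 - c' 1 * q 0)
      + r ^ 2 * c' 2 * (q 0 * c'' 1 - q 1 * c'' 0)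
      - 2 * c' 2 * (p 0 * p' 1 - p 1 * p' 0) * (c' 0 * q 0 + c' 1 * q 1)
      + c' 2 * (p 0 * q 1 - p 1 * q 0) * (2 * (c' 0 * p' 0 + c' 1 * p' 1)))
    (e2 := r ^ 2 * c'' 2 * (c' 1 * p 0 - c' 0 * p 1)
      - r ^ 2 * c' 2 * (p 0 * c'' 1 - p 1 * c'' 0)
      + 2 * c' 2 * (p 0 * p' 1 - p 1 * p' 0) * (c' 0 * p 0 + c' 1 * p 1)
      + c' 2 * (p 0 * q 1 - p 1 * q 0) * (2 * (c' 0 * q' 0 + c' 1 * q' 1)))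
    (e3 := r ^ 2 * c' 2 * (q 0 * p'' 1 - q 1 * p'' 0)
      - 2 * c' 2 * (p 0 * p' 1 - p 1 * p' 0) * (p' 0 * q 0 + p' 1 * q 1)
      + c' 2 * (p 0 * q 1 - p 1 * q 0) * (p' 0 ^ 2 + p' 1 ^ 2))
    (e4 := r ^ 2 * c' 2 * (q 0 * q'' 1 - q 1 * q'' 0 - (p 0 * p'' 1 - p 1 * p'' 0))
      - 2 * c' 2 * (p 0 * p' 1 - p 1 * p' 0) * (q' 0 * q 0 + q' 1 * q 1 - p' 0 * p 0 - p' 1 * p 1)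
      + c' 2 * (p 0 * q 1 - p 1 * q 0) * (2 * (p' 0 * q' 0 + p' 1 * q' 1)))
    (e5 := -r ^ 2 * c' 2 * (p 0 * q'' 1 - p 1 * q'' 0)
      + 2 * c' 2 * (p 0 * p' 1 - p 1 * p' 0) * (q' 0 * p 0 + q' 1 * p 1)
      + c' 2 * (p 0 * q 1 - p 1 * q 0) * (q' 0 ^ 2 + q' 1 ^ 2)) hk
    fun θ x y hx hy => by
      have hxy : x ^ 2 + y ^ 2 = 1 := by rw [hx, hy]; exact Real.cos_sq_add_sin_sq θ
      have hθ := h θ x y hx hy _ _ rfl rfl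
      simp only [inner_eq, cross_apply_zero, cross_apply_one, cross_apply_two, PiLp.add_apply,
        PiLp.sub_apply, PiLp.neg_apply, PiLp.smul_apply, smul_eq_mul, hp, hq, hp', hq', hp'',
        hq''] at hθ
      -- The relations `h1` and `h2` remove the degree-two part of N₃.
      have hJ : (c' 0 + (x * p' 0 + y * q' 0)) * (x * q 1 - y * p 1)
          - (c' 1 + (x * p' 1 + y * q' 1)) * (x * q 0 - y * p 0)
          = (p' 0 * q 1 - p' 1 * q 0) + (c' 0 * q 1 - c' 1 * q 0) * x
            + (c' 1 * p 0 - c' 0 * p 1) * y := by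
        linear_combination (p' 0 * q 1 - p' 1 * q 0) * hxy - x * y * h1 - y ^ 2 * h2
      have hM : (x * q 0 - y * p 0) * (x * q' 1 - y * p' 1)
          - (x * q 1 - y * p 1) * (x * q' 0 - y * p' 0) = p 0 * p' 1 - p 1 * p' 0 := by
        linear_combination (p 0 * p' 1 - p 1 * p' 0) * hxy + x ^ 2 * h1 + x * y * h2
      have hP : (x * q 1 - y * p 1) * (x * p 0 + y * q 0)
          - (x * q 0 - y * p 0) * (x * p 1 + y * q 1) = p 0 * q 1 - p 1 * q 0 := by
        linear_combination (p 0 * q 1 - p 1 * q 0) * hxy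
      have hG : (x * q 0 - y * p 0) ^ 2 + (x * q 1 - y * p 1) ^ 2 = r ^ 2 := by
        linear_combination r ^ 2 * hxy + x ^ 2 * hqq + y ^ 2 * hpp - 2 * x * y * hpq
      rw [hJ, hG] at hθ
      rw [hθ]
      linear_combination (-2 * c' 2 * ((c' 0 + (x * p' 0 + y * q' 0)) * (x * q 0 - y * p 0)
          + (c' 1 + (x * p' 1 + y * q' 1)) * (x * q 1 - y * p 1))) * hM
        + c' 2 * ((c' 0 + (x * p' 0 + y * q' 0)) ^ 2 + (c' 1 + (x * p' 1 + y * q' 1)) ^ 2) * hP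
  -- By Lagrange's identity the square of this determinant is |p|²|q|² - ⟨p, q⟩² = r⁴. The
  -- horizontal part of c' is then recovered from A and B by Cramer's rule.
  have hκ : p 0 * q 1 - p 1 * q 0 ≠ 0 := by
    intro h0
    have : (r ^ 2) ^ 2 = 0 := by
      linear_combination (p 0 * q 1 - p 1 * q 0) * h0 - (q 0 ^ 2 + q 1 ^ 2) * hpp
        - r ^ 2 * hqq + (p 0 * q 0 + p 1 * q 1) * hpq
    exact hr (by simpa using this)
  constructor
  · refine (mul_eq_zero.1 (?_ : c' 0 * (p 0 * q 1 - p 1 * q 0) = 0)).resolve_right hκ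
    linear_combination p 0 * hA + q 0 * hB
  · refine (mul_eq_zero.1 (?_ : c' 1 * (p 0 * q 1 - p 1 * q 0) = 0)).resolve_right hκ
    linear_combination p 1 * hA + q 1 * hB

end ParamSurface

/-! ### Coaxial circles and invariance under rotations. -/

namespace CyclicSurface

variable {S : CyclicSurface}

/-- If the planes of the foliation are horizontal, the centres lie on a vertical line. -/
theorem IsDirichletCAMC.center_eq {Λ : ℝ} (hΛ : Λ ≠ 0) (hS : S.IsDirichletCAMC Λ)
    (hu : ∀ s ∈ S.I, S.u s 2 = 0) (hv : ∀ s ∈ S.I, S.v s 2 = 0) {s t : ℝ} (hs : s ∈ S.I)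
    (ht : t ∈ S.I) : S.c s 0 = S.c t 0 ∧ S.c s 1 = S.c t 1 := by
  have hI := S.isOpen_I
  have hdp := S.smooth_p.deriv_of_isOpen hI (m := ∞) (by simp)
  have hdq := S.smooth_q.deriv_of_isOpen hI (m := ∞) (by simp)
  have p0 : ∀ x ∈ S.I, S.p x 2 = 0 := fun x hx => by simp [p, hu x hx]
  have q0 : ∀ x ∈ S.I, S.q x 2 = 0 := fun x hx => by simp [q, hv x hx]
  have p1 : ∀ x ∈ S.I, deriv S.p x 2 = 0 := fun x hx =>
    (S.smooth_p.hasDerivAt_deriv hI hx).apply_eq_zero hI hx p0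
  have q1 : ∀ x ∈ S.I, deriv S.q x 2 = 0 := fun x hx =>
    (S.smooth_q.hasDerivAt_deriv hI hx).apply_eq_zero hI hx q0
  have key : ∀ x ∈ S.I, deriv S.c x 0 = 0 ∧ deriv S.c x 1 = 0 := fun x hx =>
    horizontal_velocity_eq_zero (div_ne_zero hΛ two_ne_zero) (S.r_pos x hx).ne'
      (hS.equation hx) (p0 x hx) (q0 x hx) (p1 x hx) (q1 x hx)
      ((hdp.hasDerivAt_deriv hI hx).apply_eq_zero hI hx p1)
      ((hdq.hasDerivAt_deriv hI hx).apply_eq_zero hI hx q1)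
      (by rw [p, inner_smul_left, inner_smul_right, S.inner_u_u hx, conj_trivial]; ring)
      (by rw [q, inner_smul_left, inner_smul_right, S.inner_v_v hx, conj_trivial]; ring)
      (by rw [p, q, inner_smul_left, inner_smul_right, S.inner_u_v hx]; ring)
  constructor
  · exact eq_of_hasDerivAt_zero (f := fun y => S.c y 0) (fun y hy =>
      (key y hy).1 ▸ (S.smooth_c.hasDerivAt_deriv hI hy).coord 0) hs ht
  · exact eq_of_hasDerivAt_zero (f := fun y => S.c y 1) (fun y hy =>
      (key y hy).2 ▸ (S.smooth_c.hasDerivAt_deriv hI hy).coord 1) hs ht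

/-- Every unit vector in the span of an orthonormal pair is on its circle. -/
theorem exists_eq_cos_smul_add_sin_smul {u v x : E3} (huu : inner ℝ u u = (1 : ℝ))
    (hvv : inner ℝ v v = (1 : ℝ)) (huv : inner ℝ u v = (0 : ℝ))
    (hx : x ∈ Submodule.span ℝ {u, v}) (hxx : inner ℝ x x = (1 : ℝ)) :
    ∃ θ : ℝ, x = Real.cos θ • u + Real.sin θ • v := by
  obtain ⟨α, β, rfl⟩ := Submodule.mem_span_pair.1 hx
  have h1 : α ^ 2 + β ^ 2 = 1 := by
    simp only [inner_add_left, inner_add_right, inner_smul_left, inner_smul_right, huu, hvv, huv,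
      real_inner_comm u v, conj_trivial] at hxx
    linarith
  let z : ℂ := ⟨α, β⟩
  have hz : ‖z‖ = 1 := by
    rw [← sq_eq_sq₀ (norm_nonneg _) zero_le_one, ← Complex.normSq_eq_norm_sq, Complex.normSq_mk]
    linarith
  have hz0 : z ≠ 0 := by
    rw [← norm_ne_zero_iff, hz]; exact one_ne_zero
  refine ⟨z.arg, ?_⟩
  rw [Complex.cos_arg hz0, Complex.sin_arg, hz, div_one, div_one]

/-- A rotation about a vertical axis through the centres maps a surface of horizontal circles into
itself. -/
theorem rotation_mem_carrier {o : E3}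
    (hspan : ∀ s ∈ S.I, Submodule.span ℝ {S.u s, S.v s} = (Submodule.span ℝ {e3})ᗮ)
    (hc : ∀ s ∈ S.I, S.c s - o ∈ Submodule.span ℝ {e3}) (ρ : E3 ≃ₗᵢ[ℝ] E3) (hρ : ρ e3 = e3)
    {x : E3} (hx : x ∈ S.carrier) : o + ρ (x - o) ∈ S.carrier := by
  obtain ⟨s, hs, θ, rfl⟩ := hx
  obtain ⟨h, hh⟩ := Submodule.mem_span_singleton.1 (hc s hs)
  set y := Real.cos θ • S.u s + Real.sin θ • S.v s with hy
  have huu := S.inner_u_u hs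
  have hvv := S.inner_v_v hs
  have huv := S.inner_u_v hs
  have hyy : inner ℝ y y = (1 : ℝ) := by
    simp only [hy, inner_add_left, inner_add_right, inner_smul_left, inner_smul_right, huu, hvv,
      huv, real_inner_comm (S.u s) (S.v s), conj_trivial]
    linear_combination Real.cos_sq_add_sin_sq θ
  have hmem : y ∈ Submodule.span ℝ {S.u s, S.v s} := Submodule.mem_span_pair.2 ⟨_, _, rfl⟩
  -- An isometry fixing e₃ preserves the orthogonal complement of e₃, which is the direction of
  -- every plane.
  have hρy : ρ y ∈ Submodule.span ℝ {S.u s, S.v s} := by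
    rw [hspan s hs, Submodule.mem_orthogonal_singleton_iff_inner_right] at hmem ⊢
    rw [← hρ, ρ.inner_map_map]
    exact hmem
  obtain ⟨φ, hφ⟩ := exists_eq_cos_smul_add_sin_smul huu hvv huv hρy
    (by rw [ρ.inner_map_map, hyy])
  refine ⟨s, hs, φ, ?_⟩
  rw [X, X, ← hφ, ← hy, add_sub_right_comm, ← hh, map_add, map_smul, map_smul, hρ, hh]
  abel

end CyclicSurface

theorem theorem1p5 (S : CyclicSurface) (Λ : ℝ) (hΛ : Λ ≠ 0) (hS : S.IsDirichletCAMC Λ) :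
    (∀ s ∈ S.I, ∀ t ∈ S.I, (S.plane s).Parallel (S.plane t)) ∧
    ((∀ s ∈ S.I, (S.plane s).Parallel xyPlane) →
      ∃ p : E3, S.IsSurfaceOfRevolutionAbout p e3) := by
  refine ⟨fun s hs t ht => hS.parallel hΛ hs ht, fun hpar => ?_⟩
  have hspan : ∀ s ∈ S.I, Submodule.span ℝ {S.u s, S.v s} = (Submodule.span ℝ {e3})ᗮ :=
    fun s hs => by
      have := (hpar s hs).direction_eq
      rwa [CyclicSurface.plane, xyPlane, AffineSubspace.direction_mk',
        AffineSubspace.direction_mk'] at this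
  have horiz : ∀ s ∈ S.I, ∀ x ∈ Submodule.span ℝ {S.u s, S.v s}, x 2 = 0 := fun s hs x hx => by
    rw [hspan s hs, Submodule.mem_orthogonal_singleton_iff_inner_left] at hx
    rwa [inner_e3_right] at hx
  have hu : ∀ s ∈ S.I, S.u s 2 = 0 := fun s hs =>
    horiz s hs _ (Submodule.subset_span (by simp))
  have hv : ∀ s ∈ S.I, S.v s 2 = 0 := fun s hs =>
    horiz s hs _ (Submodule.subset_span (by simp))
  obtain ⟨s₀, hs₀⟩ := S.nonempty_I
  have hc : ∀ s ∈ S.I, S.c s - S.c s₀ ∈ Submodule.span ℝ {e3} := fun s hs => by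
    obtain ⟨h0, h1⟩ := hS.center_eq hΛ hu hv hs hs₀
    refine Submodule.mem_span_singleton.2 ⟨S.c s 2 - S.c s₀ 2, ?_⟩
    ext i
    fin_cases i <;> simp [e3, h0, h1]
  have he3 : e3 ≠ 0 := fun h => by
    have := congrArg (fun x : E3 => x 2) h
    simp [e3] at this
  refine ⟨S.c s₀, he3, fun ρ _ hρ => ?_, fun s hs => ⟨?_, ?_⟩⟩
  · apply Set.Subset.antisymm
    · rintro _ ⟨x, hx, rfl⟩
      exact CyclicSurface.rotation_mem_carrier hspan hc ρ hρ hx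
    -- The preimage of x is its image under the inverse rotation, which also fixes e₃.
    · intro x hx
      refine ⟨S.c s₀ + ρ.symm (x - S.c s₀), CyclicSurface.rotation_mem_carrier hspan hc ρ.symm
        (by rw [LinearIsometryEquiv.symm_apply_eq, hρ]) hx, ?_⟩
      simp
  · rw [AffineSubspace.mem_mk']
    exact hc s hs
  · rw [CyclicSurface.plane, AffineSubspace.direction_mk', hspan s hs]
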